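/- Let $\mathcal{L}_{\mathrm{of}}=\{+,\cdot,-,0,1,<\}$ be the language of ordered fields, let $\mathcal{L}\supseteq\mathcal{L}_{\mathrm{of}}$ be a first-order language (of any cardinality), and let $K$ be an $\mathcal{L}$-structure whose $\mathcal{L}_{\mathrm{of}}$-reduct is an ordered field $(K,<)$. Let $v$ be a valuation on $K$ (possibly trivial) with valuation ring $\mathcal{O}_v$, and suppose that $v$ is convex, i.e. that $$\{x\in K : x<a \text{ and } -x<a \text{ for some } a\in\mathcal{O}_v\}=\mathcal{O}_v .$$ Call a complete theory $T$ NIP if for every partitioned formula $\varphi(\bar x;\bar y)$ there is an $n\in\mathbb{N}$ such that no model $M$ of $T$ contains tuples $\bar a_i$ $(i<n)$ and $\bar b_s$ $(s\subseteq\{0,\dots,n-1\})$ with $M\models\varphi(\bar a_i;\bar b_s)\iff i\in s$ for all $i$ and $s$. If the complete $\mathcal{L}$-theory of $K$ is NIP, then the complete theory of $(K,v)$ in the language $\mathcal{L}\cup\{\mathcal{O}_v\}$ is NIP, where $(K,v)$ denotes the expansion of the $\mathcal{L}$-structure $K$ by a new unary predicate interpreted as the valuation ring $\mathcal{O}_v$.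 -/

import Mathlib

open FirstOrder

universe u v w x

namespace FirstOrder.Language

section NIP

variable {L : Language.{u, v}}

/-- The partitioned formula `φ(x; y)` shatters a set of `n` tuples in `M`: there are
`x`-tuples `a i` (`i < n`) and `y`-tuples `b s` (`s ⊆ {0, …, n - 1}`) in `M` such that
`M ⊨ φ(a i; b s)` if and only if `i ∈ s`. -/
def Formula.Shatters {k m : ℕ} (φ : L.Formula (Fin k ⊕ Fin m)) (M : Type x) [L.Structure M]
    (n : ℕ) : Prop :=
  ∃ (a : Fin n → Fin k → M) (b : Set (Fin n) → Fin m → M),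
    ∀ (i : Fin n) (s : Set (Fin n)), φ.Realize (Sum.elim (a i) (b s)) ↔ i ∈ s

/-- The partitioned formula `φ(x; y)` is NIP (does not have the independence property) in the
theory `T`: for some `n` it shatters no set of `n` tuples in any model of `T`.

The universe `max u v w` of the models is large enough to contain, up to elementary equivalence,
every model of `T`; the parameter `w` only makes room for (lifts of) structures in `Type w`. -/
def Formula.IsNIPIn {k m : ℕ} (φ : L.Formula (Fin k ⊕ Fin m)) (T : L.Theory) : Prop :=
  ∃ n : ℕ, ∀ M : Theory.ModelType.{u, v, max u v w} T, ¬ φ.Shatters M n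

/-- A theory is NIP if every partitioned formula `φ(x; y)` is NIP in it. -/
def Theory.IsNIP (T : L.Theory) : Prop :=
  ∀ (k m : ℕ) (φ : L.Formula (Fin k ⊕ Fin m)), Formula.IsNIPIn.{u, v, w} φ T

end NIP

section OrderedField

/-- The only relation symbol of the language of ordered fields is the binary symbol `<`. -/
inductive orderedFieldRel : ℕ → Type
  | lt : orderedFieldRel 2

/-- The language `{+, ·, -, 0, 1, <}` of ordered fields. -/
def orderedField : Language.{0, 0} where
  Functions := ringFunc
  Relations := orderedFieldRel

/-- Every ordered field is a structure in the language of ordered fields. -/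
instance orderedField.instStructure (K : Type w) [Field K] [LinearOrder K] :
    orderedField.Structure K where
  funMap := fun {_} f =>
    match f with
    | .add => fun z => z 0 + z 1
    | .mul => fun z => z 0 * z 1
    | .neg => fun z => - z 0
    | .zero => fun _ => 0
    | .one => fun _ => 1
  RelMap := fun {_} r =>
    match r with
    | .lt => fun z => z 0 < z 1

end OrderedField

section Predicate

/-- The only symbol of `Language.predicate` is a unary relation symbol. -/
inductive predicateRel : ℕ → Type
  | mem : predicateRel 1

/-- The language with a single unary relation symbol. -/
def predicate : Language.{0, 0} where
  Functions := fun _ => Empty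
  Relations := predicateRel

/-- The structure on `M` in which the unary relation symbol is interpreted as the set `S`. -/
@[reducible]
def predicate.structure {M : Type w} (S : Set M) : predicate.Structure M where
  funMap := fun f => f.elim
  RelMap := fun {_} r =>
    match r with
    | .mem => fun z => z 0 ∈ S

/-- For an `L`-structure `M` and `S ⊆ M`, the complete theory of the expansion `(M, S)` of `M` in
the language consisting of `L` and a new unary relation symbol, interpreted as `S`. -/
def completeTheoryWithPredicate (L : Language.{u, v}) (M : Type w) [L.Structure M] (S : Set M) :
    (L.sum predicate).Theory :=
  letI := predicate.structure S
  (L.sum predicate).completeTheory M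

end Predicate

end FirstOrder.Language

section Convex

variable {K : Type w} [Field K] [LinearOrder K]

/-- The `<`-convex hull of a subring `R` of an ordered field `K`: all `x` such that
`x < a` and `-x < a` for some `a ∈ R`. -/
def ltConvexHull (R : Subring K) : Set K :=
  {z | ∃ a ∈ R, z < a ∧ -z < a}

/-- A valuation on an ordered field is convex if its valuation ring is equal to its own
`<`-convex hull. -/
def Valuation.IsLTConvex {Γ₀ : Type x} [LinearOrderedCommGroupWithZero Γ₀]
    (val : Valuation K Γ₀) : Prop :=
  ltConvexHull val.integer = (val.integer : Set K)

end Convex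

/-!
A convex valuation ring `𝒪` of an ordered field `K` is the union of the intervals `(-c, c)` with
`c ∈ 𝒪`, hence every finite subset of `𝒪` lies in a member, contained in `𝒪`, of a single definable
family. Such a family is called an honest definition of `𝒪` (`HasHonestDefinition`). The theorem
thus follows from the theorem of Shelah that expanding a NIP structure `M` by a set with an honest
definition (or, what is the same, by an externally definable set) preserves NIP.

The proof shows that every set definable in the expansion has an honest definition in `M`, by
induction on formulas. Honest definitions pass to unions, to preimages under terms and to
projections for simple reasons. The complement of a set with an honest definition is at least
externally definable: on each finite set it agrees with a member of some definable family. In a NIP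
structure an externally definable set has an honest definition (Chernikov and Simon), which is
`IsNIPStructure.hasHonestDefinition`. Once the sets defined by a formula of the expansion agree on
finite sets with members of an `L`-definable family, shattering by the former gives shattering by
the latter.

The existence of honest definitions is proved inside `M`, with ultrafilters in place of saturated
extensions (`exists_mem_coversFinitely`). Let `φ(x; c)` approximate `X`, and let `D` be an
ultrafilter containing `X`. As `φ` is NIP, some pattern `s` of length `n` is omitted by `φ` on almost
all `n`-tuples with respect to the `n`-fold product of `D`, so the trace of `X` on such a tuple is
never `s`. Take the first `k` such that some definable set `θ`, large for the `(k + 1)`-fold product,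
contains no tuple on which the trace of `X` is the initial part of `s`. A `k`-tuple `d` with the
right trace then forces the fibre of `θ` over `d` to be disjoint from `X` or contained in `X`; the
former is impossible because `X ∈ D`. By minimality of `k`, such `d` can be chosen with the fibre
containing any prescribed finite subset of a set `U ∈ D`. Compactness of the space of ultrafilters
yields finitely many such `U` covering `X`.
-/

/-! ### Sets approximated by definable families -/

namespace FirstOrder.Language

section HonestDefinitions

variable (L : Language.{u, v}) {M : Type w} [L.Structure M]

/-- The family `ψ(x; d)`, `d` a tuple from `M`, covers finite subsets of `U` within `X`: every
finite subset of `U` is contained in some member of the family that is contained in `X`. -/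
def CoversFinitely {α : Type} (X U : Set (α → M)) : Prop :=
  ∃ (β : Type) (_ : Finite β) (ψ : L.Formula (α ⊕ β)), ∀ F : Set (α → M), F.Finite → F ⊆ U →
    ∃ d : β → M, (∀ a ∈ F, ψ.Realize (Sum.elim a d)) ∧ ∀ a, ψ.Realize (Sum.elim a d) → a ∈ X

/-- A set `X` of tuples has an honest definition if a single definable family covers every finite
subset of `X` by a member contained in `X`. -/
def HasHonestDefinition {α : Type} (X : Set (α → M)) : Prop :=
  CoversFinitely L X X

/-- A set of tuples is externally definable if it is the trace of a set that is definable with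
parameters in an elementary extension. By compactness this means that a single definable family
(with parameters in `M` itself) induces the right trace on each finite set, which is the form used
here. -/
def IsExternallyDefinable {α : Type} (X : Set (α → M)) : Prop :=
  ∃ (β : Type) (_ : Finite β) (φ : L.Formula (α ⊕ β)), ∀ F : Set (α → M), F.Finite →
    ∃ c : β → M, ∀ a ∈ F, φ.Realize (Sum.elim a c) ↔ a ∈ X

variable {L}

theorem CoversFinitely.mono {α : Type} {X U V : Set (α → M)} (h : CoversFinitely L X U)
    (hVU : V ⊆ U) : CoversFinitely L X V := by
  obtain ⟨β, hβ, ψ, hψ⟩ := h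
  exact ⟨β, hβ, ψ, fun F hF hFV => hψ F hF (hFV.trans hVU)⟩

theorem coversFinitely_empty {α : Type} (X : Set (α → M)) : CoversFinitely L X ∅ := by
  refine ⟨Empty, inferInstance, ⊥, fun F _ hF => ⟨Empty.elim, fun a ha => (hF ha).elim, ?_⟩⟩
  intro a ha
  exact (BoundedFormula.realize_bot.1 ha).elim

theorem CoversFinitely.union {α : Type} {X U V : Set (α → M)} (hU : CoversFinitely L X U)
    (hV : CoversFinitely L X V) : CoversFinitely L X (U ∪ V) := by
  obtain ⟨β, hβ, ψ, hψ⟩ := hU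
  obtain ⟨γ, hγ, χ, hχ⟩ := hV
  refine ⟨β ⊕ γ, inferInstance, ψ.relabel (Sum.map id Sum.inl) ⊔ χ.relabel (Sum.map id Sum.inr),
    fun F hF hFUV => ?_⟩
  obtain ⟨d, hd, hdX⟩ := hψ (F ∩ U) (hF.subset Set.inter_subset_left) Set.inter_subset_right
  obtain ⟨e, he, heX⟩ := hχ (F ∩ V) (hF.subset Set.inter_subset_left) Set.inter_subset_right
  have key (a : α → M) : (ψ.relabel (Sum.map id Sum.inl : α ⊕ β → α ⊕ (β ⊕ γ)) ⊔
      χ.relabel (Sum.map id Sum.inr)).Realize (Sum.elim a (Sum.elim d e)) ↔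
      ψ.Realize (Sum.elim a d) ∨ χ.Realize (Sum.elim a e) := by
    rw [Formula.realize_sup, Formula.realize_relabel, Formula.realize_relabel]
    simp [Sum.elim_comp_map]
  refine ⟨Sum.elim d e, fun a ha => (key a).2 ?_, fun a ha => ((key a).1 ha).elim (hdX a) (heX a)⟩
  exact (hFUV ha).imp (fun h => hd a ⟨ha, h⟩) (fun h => he a ⟨ha, h⟩)

theorem HasHonestDefinition.isExternallyDefinable {α : Type} {X : Set (α → M)}
    (h : HasHonestDefinition L X) : IsExternallyDefinable L X := by
  obtain ⟨β, hβ, ψ, hψ⟩ := h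
  refine ⟨β, hβ, ψ, fun F hF => ?_⟩
  obtain ⟨d, hd, hdX⟩ := hψ (F ∩ X) (hF.subset Set.inter_subset_left) Set.inter_subset_right
  exact ⟨d, fun a ha => ⟨hdX a, fun haX => hd a ⟨ha, haX⟩⟩⟩

theorem IsExternallyDefinable.compl {α : Type} {X : Set (α → M)}
    (h : IsExternallyDefinable L X) : IsExternallyDefinable L Xᶜ := by
  obtain ⟨β, hβ, φ, hφ⟩ := h
  refine ⟨β, hβ, φ.not, fun F hF => ?_⟩
  obtain ⟨c, hc⟩ := hφ F hF
  exact ⟨c, fun a ha => by rw [Formula.realize_not, hc a ha, Set.mem_compl_iff]⟩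

theorem hasHonestDefinition_setOf_realize {α : Type} (φ : L.Formula α) :
    HasHonestDefinition L {a : α → M | φ.Realize a} := by
  refine ⟨Empty, inferInstance, φ.relabel Sum.inl, fun F _ hFX => ⟨Empty.elim, ?_⟩⟩
  simp only [Formula.realize_relabel, Sum.elim_comp_inl]
  exact ⟨fun a ha => hFX ha, fun a ha => ha⟩

theorem HasHonestDefinition.union {α : Type} {X Y : Set (α → M)} (hX : HasHonestDefinition L X)
    (hY : HasHonestDefinition L Y) : HasHonestDefinition L (X ∪ Y) := by
  have enlarge {Z : Set (α → M)} (hZ : HasHonestDefinition L Z) (hZXY : Z ⊆ X ∪ Y) :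
      CoversFinitely L (X ∪ Y) Z := by
    obtain ⟨β, hβ, ψ, hψ⟩ := hZ
    refine ⟨β, hβ, ψ, fun F hF hFZ => ?_⟩
    obtain ⟨d, hd, hdZ⟩ := hψ F hF hFZ
    exact ⟨d, hd, fun a ha => hZXY (hdZ a ha)⟩
  exact (enlarge hX Set.subset_union_left).union (enlarge hY Set.subset_union_right)

theorem HasHonestDefinition.preimage_terms {α γ : Type} {X : Set (γ → M)}
    (hX : HasHonestDefinition L X) (t : γ → L.Term α) :
    HasHonestDefinition L {a : α → M | (fun i => (t i).realize a) ∈ X} := by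
  obtain ⟨β, hβ, ψ, hψ⟩ := hX
  refine ⟨β, hβ, ψ.subst (Sum.elim (fun i => (t i).relabel Sum.inl) fun j => Term.var (Sum.inr j)),
    fun F hF hFX => ?_⟩
  obtain ⟨d, hd, hdX⟩ := hψ ((fun a i => (t i).realize a) '' F) (hF.image _) (by
    rintro _ ⟨a, ha, rfl⟩
    exact hFX ha)
  have key (a : α → M) :
      Formula.Realize (ψ.subst (Sum.elim (fun i => (t i).relabel Sum.inl)
        fun j => Term.var (Sum.inr j) : γ ⊕ β → L.Term (α ⊕ β))) (Sum.elim a d) ↔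
      ψ.Realize (Sum.elim (fun i => (t i).realize a) d) := by
    rw [Formula.Realize, BoundedFormula.realize_subst, Formula.Realize]
    have : (fun i : γ ⊕ β => ((Sum.elim (fun i => (t i).relabel Sum.inl)
        fun j => Term.var (Sum.inr j) : γ ⊕ β → L.Term (α ⊕ β)) i).realize (Sum.elim a d)) =
        Sum.elim (fun i => (t i).realize a) d := by
      ext (i | j) <;> simp
    rw [this]
  exact ⟨d, fun a ha => (key a).2 (hd _ ⟨a, ha, rfl⟩), fun a ha => hdX _ ((key a).1 ha)⟩

/-- Honest definitions survive projections: members of the family that lie inside `X` have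
projections inside the projection of `X`. The analogous
argument fails for families that only have the right trace on finite sets. -/
theorem HasHonestDefinition.exists {α γ : Type} [Finite γ] {X : Set (α ⊕ γ → M)}
    (hX : HasHonestDefinition L X) :
    HasHonestDefinition L {a : α → M | ∃ c : γ → M, Sum.elim a c ∈ X} := by
  obtain ⟨β, hβ, ψ, hψ⟩ := hX
  let e : (α ⊕ γ) ⊕ β → (α ⊕ β) ⊕ γ :=
    Sum.elim (Sum.elim (fun i => Sum.inl (Sum.inl i)) Sum.inr) (fun j => Sum.inl (Sum.inr j))
  have key (a : α → M) (d : β → M) : ((ψ.relabel e).iExs γ).Realize (Sum.elim a d) ↔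
      ∃ c : γ → M, ψ.Realize (Sum.elim (Sum.elim a c) d) := by
    rw [Formula.realize_iExs]
    refine exists_congr fun c => ?_
    rw [Formula.realize_relabel]
    have : Sum.elim (Sum.elim a d) c ∘ e = Sum.elim (Sum.elim a c) d := by
      ext ((i | i) | i) <;> rfl
    rw [this]
  refine ⟨β, hβ, (ψ.relabel e).iExs γ, fun F hF hFX => ?_⟩
  choose c hc using fun a : F => hFX a.2
  have := hF.to_subtype
  obtain ⟨d, hd, hdX⟩ := hψ (Set.range fun a : F => Sum.elim a.1 (c a)) (Set.finite_range _) (by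
    rintro _ ⟨a, rfl⟩
    exact hc a)
  refine ⟨d, fun a ha => (key a d).2 ⟨c ⟨a, ha⟩, hd _ ⟨⟨a, ha⟩, rfl⟩⟩, fun a ha => ?_⟩
  obtain ⟨c', hc'⟩ := (key a d).1 ha
  exact ⟨c', hdX _ hc'⟩

end HonestDefinitions

/-! ### Externally definable sets in NIP structures -/

section IteratedUltrafilter

/-- The `k`-fold product `D ⊗ ⋯ ⊗ D` of an ultrafilter `D`, as an ultrafilter on `k`-tuples. The
last coordinate is quantified first: `θ` is large if for `D`-almost all `x`, the fibre of `θ` over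
last coordinate `x` is large. -/
def iteratedUltrafilter {V : Type w} (D : Ultrafilter V) : (k : ℕ) → Ultrafilter (Fin k → V)
  | 0 => pure Fin.elim0
  | k + 1 => D.bind fun x => (iteratedUltrafilter D k).map fun d => Fin.snoc d x

theorem mem_iteratedUltrafilter_succ {V : Type w} {D : Ultrafilter V} {k : ℕ}
    {θ : Set (Fin (k + 1) → V)} :
    θ ∈ iteratedUltrafilter D (k + 1) ↔
      {x | {d : Fin k → V | (Fin.snoc d x : Fin (k + 1) → V) ∈ θ} ∈ iteratedUltrafilter D k} ∈ D :=
  Iff.rfl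

end IteratedUltrafilter

section NIPStructure

variable {L : Language.{u, v}} {M : Type w} [L.Structure M]

/-- A set of `k`-tuples of points of `M ^ α` that is definable with parameters. -/
def IsParamDefinable (L : Language.{u, v}) {M : Type w} [L.Structure M] {α : Type} {k : ℕ}
    (θ : Set (Fin k → α → M)) : Prop :=
  ∃ (γ : Type) (_ : Finite γ) (χ : L.Formula ((Fin k × α) ⊕ γ)) (m : γ → M),
    ∀ d, d ∈ θ ↔ χ.Realize (Sum.elim (fun p => d p.1 p.2) m)

theorem isParamDefinable_univ {α : Type} {k : ℕ} :
    IsParamDefinable L (Set.univ : Set (Fin k → α → M)) :=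
  ⟨Empty, inferInstance, ⊤, Empty.elim, fun d => by simp⟩

theorem IsParamDefinable.inter {α : Type} {k : ℕ} {θ θ' : Set (Fin k → α → M)}
    (h : IsParamDefinable L θ) (h' : IsParamDefinable L θ') : IsParamDefinable L (θ ∩ θ') := by
  obtain ⟨γ, hγ, χ, m, hχ⟩ := h
  obtain ⟨γ', hγ', χ', m', hχ'⟩ := h'
  refine ⟨γ ⊕ γ', inferInstance, χ.relabel (Sum.map id Sum.inl) ⊓ χ'.relabel (Sum.map id Sum.inr),
    Sum.elim m m', fun d => ?_⟩
  rw [Formula.realize_inf, Formula.realize_relabel, Formula.realize_relabel, Set.mem_inter_iff,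
    hχ, hχ']
  simp [Sum.elim_comp_map]

theorem IsParamDefinable.fiber {α : Type} [Finite α] {k : ℕ} {θ : Set (Fin (k + 1) → α → M)}
    (h : IsParamDefinable L θ) (x : α → M) :
    IsParamDefinable L {d : Fin k → α → M | (Fin.snoc d x : Fin (k + 1) → α → M) ∈ θ} := by
  obtain ⟨γ, hγ, χ, m, hχ⟩ := h
  let e : (Fin (k + 1) × α) ⊕ γ → (Fin k × α) ⊕ (γ ⊕ α) :=
    Sum.elim (fun p => Fin.lastCases (motive := fun _ => (Fin k × α) ⊕ (γ ⊕ α))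
      (Sum.inr (Sum.inr p.2)) (fun i => Sum.inl (i, p.2)) p.1) fun j => Sum.inr (Sum.inl j)
  refine ⟨γ ⊕ α, inferInstance, χ.relabel e, Sum.elim m x, fun d => ?_⟩
  rw [Set.mem_ofPred_eq, hχ, Formula.realize_relabel]
  have : Sum.elim (fun p => d p.1 p.2) (Sum.elim m x) ∘ e =
      Sum.elim (fun p => (Fin.snoc d x : Fin (k + 1) → α → M) p.1 p.2) m := by
    ext (⟨i, j⟩ | j)
    · refine Fin.lastCases ?_ (fun i => ?_) i <;> simp [e]
    · rfl
  rw [this]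

theorem IsParamDefinable.biInter_fiber {α : Type} [Finite α] {k : ℕ}
    {θ : Set (Fin (k + 1) → α → M)} (h : IsParamDefinable L θ) {F : Set (α → M)}
    (hF : F.Finite) :
    IsParamDefinable L
      (⋂ x ∈ F, {d : Fin k → α → M | (Fin.snoc d x : Fin (k + 1) → α → M) ∈ θ}) := by
  induction F, hF using Set.Finite.induction_on with
  | empty => simpa using isParamDefinable_univ
  | insert _ _ ih =>
    rw [Set.biInter_insert]
    exact (h.fiber _).inter ih

theorem isParamDefinable_not_pattern {α β : Type} [Finite β] (φ : L.Formula (α ⊕ β)) {n : ℕ}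
    (s : Set (Fin n)) :
    IsParamDefinable L
      {d : Fin n → α → M | ¬ ∃ c : β → M, ∀ i, φ.Realize (Sum.elim (d i) c) ↔ i ∈ s} := by
  classical
  let f (i : Fin n) : L.Formula ((Fin n × α) ⊕ β) := φ.relabel (Sum.map (fun j => (i, j)) id)
  let χ : L.Formula (Fin n × α) :=
    ((Formula.iInf fun i => if i ∈ s then f i else (f i).not).iExs β).not
  refine ⟨Empty, inferInstance, χ.relabel Sum.inl, Empty.elim, fun d => ?_⟩
  rw [Formula.realize_relabel, Sum.elim_comp_inl, Formula.realize_not, Formula.realize_iExs,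
    Set.mem_ofPred_eq]
  refine not_congr (exists_congr fun c => ?_)
  rw [Formula.realize_iInf]
  refine forall_congr' fun i => ?_
  have hf : (f i).Realize (Sum.elim (fun p => d p.1 p.2) c) ↔ φ.Realize (Sum.elim (d i) c) := by
    rw [Formula.realize_relabel, Sum.elim_comp_map]
    rfl
  by_cases hi : i ∈ s
  · simp [hi, hf]
  · simp [hi, hf, Formula.realize_not]

/-- The heart of the matter: near an ultrafilter containing it, an externally definable set given
by a formula without the independence property is covered, on finite sets, from inside. -/
theorem exists_mem_coversFinitely {α β : Type} [Finite α] [Finite β] (φ : L.Formula (α ⊕ β))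
    {n : ℕ}
    (hn : ¬ ∃ (a : Fin n → α → M) (b : Set (Fin n) → β → M),
      ∀ i s, φ.Realize (Sum.elim (a i) (b s)) ↔ i ∈ s)
    {X : Set (α → M)}
    (hX : ∀ F : Set (α → M), F.Finite → ∃ c : β → M, ∀ a ∈ F, φ.Realize (Sum.elim a c) ↔ a ∈ X)
    {D : Ultrafilter (α → M)} (hXD : X ∈ D) : ∃ U ∈ D, CoversFinitely L X U := by
  -- Some pattern `s` is omitted by almost every `n`-tuple.
  obtain ⟨s, hs⟩ : ∃ s : Set (Fin n),
      {d : Fin n → α → M | ¬ ∃ c : β → M, ∀ i, φ.Realize (Sum.elim (d i) c) ↔ i ∈ s} ∈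
        iteratedUltrafilter D n := by
    have hfin : (Set.univ : Set (Set (Fin n))).Finite := Set.toFinite _
    have := (Ultrafilter.finite_biUnion_mem_iff (f := iteratedUltrafilter D n) (s := fun s =>
      {d : Fin n → α → M | ¬ ∃ c : β → M, ∀ i, φ.Realize (Sum.elim (d i) c) ↔ i ∈ s}) hfin).1 (by
        refine Filter.mem_of_superset Filter.univ_mem fun d _ => ?_
        by_contra hd
        have hd' (s : Set (Fin n)) : ∃ c : β → M, ∀ i, φ.Realize (Sum.elim (d i) c) ↔ i ∈ s := by
          by_contra h
          exact hd (Set.mem_biUnion (Set.mem_univ s) h)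
        choose b hb using hd'
        exact hn ⟨d, b, fun i s => hb s i⟩)
    obtain ⟨s, -, hs⟩ := this
    exact ⟨s, hs⟩
  -- `Q k`: every large definable set of `k`-tuples contains one on which the trace of `X` is the
  -- initial part of `s`.
  let σ (i : ℕ) : Prop := ∃ h : i < n, (⟨i, h⟩ : Fin n) ∈ s
  let Q (k : ℕ) : Prop := ∀ θ : Set (Fin k → α → M), IsParamDefinable L θ →
    θ ∈ iteratedUltrafilter D k → ∃ d ∈ θ, ∀ i : Fin k, d i ∈ X ↔ σ i
  have hQ0 : Q 0 := fun θ _ hθ => ⟨Fin.elim0, hθ, fun i => i.elim0⟩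
  have hQn : ¬ Q n := fun h => by
    obtain ⟨d, hd, hdX⟩ := h _ (isParamDefinable_not_pattern φ s) hs
    obtain ⟨c, hc⟩ := hX (Set.range d) (Set.finite_range d)
    refine hd ⟨c, fun i => (hc (d i) ⟨i, rfl⟩).trans ((hdX i).trans ?_)⟩
    exact ⟨fun ⟨_, h⟩ => h, fun h => ⟨i.2, h⟩⟩
  obtain ⟨k, hk, hk'⟩ : ∃ k, Q k ∧ ¬ Q (k + 1) := by
    by_contra! h
    exact hQn (Nat.rec hQ0 h n)
  -- A large definable `θ` without such a tuple yields the covering family: its parameters are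
  -- `k`-tuples `d` with the right trace, and its members are the fibres `{x | (d, x) ∈ θ}`.
  simp only [Q, not_forall, not_exists, not_and] at hk'
  obtain ⟨θ, hθdef, hθ, hθX⟩ := hk'
  have avoid (d : Fin k → α → M) (hd : ∀ i : Fin k, d i ∈ X ↔ σ i) (x : α → M)
      (hx : (Fin.snoc d x : Fin (k + 1) → α → M) ∈ θ) : ¬ (x ∈ X ↔ σ k) := fun hxk => by
    obtain ⟨i, hi⟩ := hθX _ hx
    refine hi ?_
    refine Fin.lastCases ?_ (fun i => ?_) i
    · simpa using hxk
    · simpa using hd i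
  let U : Set (α → M) :=
    {x | {d : Fin k → α → M | (Fin.snoc d x : Fin (k + 1) → α → M) ∈ θ} ∈ iteratedUltrafilter D k}
  have hU : U ∈ D := mem_iteratedUltrafilter_succ.1 hθ
  have cover (F : Set (α → M)) (hF : F.Finite) (hFU : F ⊆ U) : ∃ d : Fin k → α → M,
      (∀ x ∈ F, (Fin.snoc d x : Fin (k + 1) → α → M) ∈ θ) ∧ ∀ i : Fin k, d i ∈ X ↔ σ i := by
    obtain ⟨d, hd, hdX⟩ := hk _ (hθdef.biInter_fiber hF) ((Filter.biInter_mem hF).2 hFU)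
    exact ⟨d, fun x hx => Set.mem_iInter₂.1 hd x hx, hdX⟩
  -- The new coordinate has to lie outside `X`, since `U` meets `X`.
  have hσ : ¬ σ k := fun hσ => by
    obtain ⟨x, hxU, hxX⟩ := D.nonempty_of_mem (Filter.inter_mem hU hXD)
    obtain ⟨d, hd, hdX⟩ := cover {x} (Set.finite_singleton x) (Set.singleton_subset_iff.2 hxU)
    exact avoid d hdX x (hd x rfl) (iff_of_true hxX hσ)
  obtain ⟨γ, hγ, χ, m, hχ⟩ := hθdef
  let e : (Fin (k + 1) × α) ⊕ γ → α ⊕ ((Fin k × α) ⊕ γ) :=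
    Sum.elim (fun p => Fin.lastCases (motive := fun _ => α ⊕ ((Fin k × α) ⊕ γ))
      (Sum.inl p.2) (fun i => Sum.inr (Sum.inl (i, p.2))) p.1) fun j => Sum.inr (Sum.inr j)
  have key (x : α → M) (d : Fin k → α → M) :
      (χ.relabel e).Realize (Sum.elim x (Sum.elim (fun p => d p.1 p.2) m)) ↔
        (Fin.snoc d x : Fin (k + 1) → α → M) ∈ θ := by
    rw [hχ, Formula.realize_relabel]
    have : Sum.elim x (Sum.elim (fun p => d p.1 p.2) m) ∘ e =
        Sum.elim (fun p => (Fin.snoc d x : Fin (k + 1) → α → M) p.1 p.2) m := by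
      ext (⟨i, j⟩ | j)
      · refine Fin.lastCases ?_ (fun i => ?_) i <;> simp [e]
      · rfl
    rw [this]
  refine ⟨U, hU, (Fin k × α) ⊕ γ, inferInstance, χ.relabel e, fun F hF hFU => ?_⟩
  obtain ⟨d, hd, hdX⟩ := cover F hF hFU
  refine ⟨Sum.elim (fun p => d p.1 p.2) m, fun x hx => (key x d).2 (hd x hx), fun x hx => ?_⟩
  by_contra hxX
  exact avoid d hdX x ((key x d).1 hx) (iff_of_false hxX hσ)

/-- No formula has the independence property in the structure `M`. -/
def IsNIPStructure (L : Language.{u, v}) (M : Type w) [L.Structure M] : Prop :=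
  ∀ (k m : ℕ) (φ : L.Formula (Fin k ⊕ Fin m)), ∃ n : ℕ, ¬ φ.Shatters M n

theorem IsNIPStructure.exists_not_shatters (hM : IsNIPStructure L M) {α β : Type} [Finite α]
    [Finite β] (φ : L.Formula (α ⊕ β)) :
    ∃ n : ℕ, ¬ ∃ (a : Fin n → α → M) (b : Set (Fin n) → β → M),
      ∀ i s, φ.Realize (Sum.elim (a i) (b s)) ↔ i ∈ s := by
  obtain ⟨k, ⟨e⟩⟩ := Finite.exists_equiv_fin α
  obtain ⟨m, ⟨f⟩⟩ := Finite.exists_equiv_fin β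
  obtain ⟨n, hn⟩ := hM k m (φ.relabel (Sum.map e f))
  refine ⟨n, fun ⟨a, b, hab⟩ => hn ⟨fun i => a i ∘ e.symm, fun s => b s ∘ f.symm, fun i s => ?_⟩⟩
  rw [Formula.realize_relabel, Sum.elim_comp_map, ← hab i s]
  simp [Function.comp_assoc]

/-- In a NIP structure every externally definable set has an honest definition. The sets `U` whose
intersection with `X` is finitely covered within `X` form an ideal; if `X` were not in it, an
ultrafilter containing `X` and avoiding this ideal would contradict `exists_mem_coversFinitely`. -/
theorem IsNIPStructure.hasHonestDefinition (hM : IsNIPStructure L M) {α : Type} [Finite α]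
    {X : Set (α → M)} (hX : IsExternallyDefinable L X) : HasHonestDefinition L X := by
  obtain ⟨β, hβ, φ, hφ⟩ := hX
  obtain ⟨n, hn⟩ := hM.exists_not_shatters φ
  by_contra hXX
  let G : Filter (α → M) := Filter.comk (fun U => CoversFinitely L X (U ∩ X))
    (by simpa using coversFinitely_empty X)
    (fun t ht s hst => ht.mono (Set.inter_subset_inter_left X hst))
    (fun s hs t ht => by simpa only [Set.union_inter_distrib_right] using hs.union ht)
  have hG : G.NeBot := by
    refine ⟨fun h => hXX ?_⟩
    have : (∅ : Set (α → M)) ∈ G := h ▸ Filter.mem_bot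
    simpa [G, HasHonestDefinition] using this
  have hle := Ultrafilter.of_le G
  have hXG : X ∈ G := by simpa [G] using coversFinitely_empty X
  obtain ⟨U, hUD, hU⟩ := exists_mem_coversFinitely φ hn hφ (hle hXG)
  have hUG : Uᶜ ∈ G := by simpa [G] using hU.mono Set.inter_subset_left
  exact (Ultrafilter.compl_mem_iff_notMem.1 (hle hUG)) hUD

theorem HasHonestDefinition.compl (hM : IsNIPStructure L M) {α : Type} [Finite α]
    {X : Set (α → M)} (hX : HasHonestDefinition L X) : HasHonestDefinition L Xᶜ :=
  hM.hasHonestDefinition hX.isExternallyDefinable.compl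

end NIPStructure

end FirstOrder.Language

/-! ### Transfer between elementarily equivalent structures -/

namespace FirstOrder.Language

section Transfer

variable {L : Language.{u, v}}

open Classical in
/-- A first-order sentence expressing that the formula `φ` shatters `n` tuples. -/
noncomputable def Formula.shattersSentence {k m : ℕ} (φ : L.Formula (Fin k ⊕ Fin m)) (n : ℕ) :
    L.Sentence :=
  let f (p : Fin n × Set (Fin n)) :
      L.Formula (Empty ⊕ ((Fin n × Fin k) ⊕ (Set (Fin n) × Fin m))) :=
    φ.relabel (Sum.inr ∘ Sum.map (fun i => (p.1, i)) fun j => (p.2, j))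
  (Formula.iInf fun p : Fin n × Set (Fin n) => if p.1 ∈ p.2 then f p else (f p).not).iExs _

theorem Formula.realize_shattersSentence {M : Type w} [L.Structure M] {k m : ℕ}
    (φ : L.Formula (Fin k ⊕ Fin m)) (n : ℕ) : M ⊨ φ.shattersSentence n ↔ φ.Shatters M n := by
  let f (p : Fin n × Set (Fin n)) :
      L.Formula (Empty ⊕ ((Fin n × Fin k) ⊕ (Set (Fin n) × Fin m))) :=
    φ.relabel (Sum.inr ∘ Sum.map (fun i => (p.1, i)) fun j => (p.2, j))
  have hf (c : (Fin n × Fin k) ⊕ (Set (Fin n) × Fin m) → M) (p : Fin n × Set (Fin n)) :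
      (f p).Realize (Sum.elim (default : Empty → M) c) ↔
        φ.Realize (Sum.elim (fun i => c (Sum.inl (p.1, i))) fun j => c (Sum.inr (p.2, j))) := by
    rw [Formula.realize_relabel, ← Function.comp_assoc, Sum.elim_comp_inr]
    have : c ∘ Sum.map (fun i => (p.1, i)) (fun j => (p.2, j)) =
        Sum.elim (fun i => c (Sum.inl (p.1, i))) fun j => c (Sum.inr (p.2, j)) := by
      ext (i | j) <;> rfl
    rw [this]
  have key (c : (Fin n × Fin k) ⊕ (Set (Fin n) × Fin m) → M) (p : Fin n × Set (Fin n))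
      [Decidable (p.1 ∈ p.2)] :
      (if p.1 ∈ p.2 then f p else (f p).not).Realize (Sum.elim (default : Empty → M) c) ↔
        (φ.Realize (Sum.elim (fun i => c (Sum.inl (p.1, i))) fun j => c (Sum.inr (p.2, j))) ↔
          p.1 ∈ p.2) := by
    by_cases hp : p.1 ∈ p.2
    · simp [hp, hf]
    · simp [hp, hf, Formula.realize_not]
  classical
  rw [Sentence.Realize, Formula.shattersSentence, Formula.realize_iExs]
  simp only [Formula.realize_iInf]
  constructor
  · rintro ⟨c, hc⟩
    exact ⟨fun i l => c (Sum.inl (i, l)), fun s l => c (Sum.inr (s, l)),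
      fun i s => (key c (i, s)).1 (hc (i, s))⟩
  · rintro ⟨a, b, hab⟩
    exact ⟨Sum.elim (fun q => a q.1 q.2) fun q => b q.1 q.2, fun p => (key _ p).2 (hab p.1 p.2)⟩

theorem isNIPStructure_of_isNIP_completeTheory {M : Type w} [L.Structure M] [Nonempty M]
    (h : Theory.IsNIP.{u, v, w} (L.completeTheory M)) : IsNIPStructure L M := by
  intro k m φ
  obtain ⟨n, hn⟩ := h k m φ
  let N : Theory.ModelType.{u, v, max u v w} (L.completeTheory M) :=
    Theory.ModelType.ulift.{u, v, w, max u v} (Theory.ModelType.of (L.completeTheory M) M)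
  refine ⟨n, fun hM => hn N ?_⟩
  exact (φ.realize_shattersSentence n).1 ((realize_iff_of_model_completeTheory M N _).2
    ((φ.realize_shattersSentence n).2 hM))

theorem IsNIPStructure.isNIP_completeTheory {M : Type w} [L.Structure M]
    (h : IsNIPStructure L M) : Theory.IsNIP.{u, v, w} (L.completeTheory M) := by
  intro k m φ
  obtain ⟨n, hn⟩ := h k m φ
  refine ⟨n, fun N hN => hn ?_⟩
  exact (φ.realize_shattersSentence n).1 ((realize_iff_of_model_completeTheory M N _).1
    ((φ.realize_shattersSentence n).2 hN))

end Transfer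

/-! ### Expansion by a set with an honest definition -/

section Expansion

variable {L : Language.{u, v}} {M : Type w} [L.Structure M]

/-- The new predicate adds no function symbols, so every term of `L ∪ {S}` is an `L`-term. -/
theorem exists_term_realize_eq (S : Set M) {α : Type} (t : (L.sum predicate).Term α) :
    letI := predicate.structure S
    ∃ t' : L.Term α, ∀ a : α → M, t'.realize a = t.realize a := by
  let _ := predicate.structure S
  induction t with
  | var i => exact ⟨Term.var i, fun a => rfl⟩
  | func f ts ih =>
    choose ts' hts' using ih
    rcases f with f | f
    · refine ⟨Term.func f ts', fun a => ?_⟩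
      simp only [Term.realize_func, hts']
      rfl
    · exact f.elim

theorem hasHonestDefinition_of_predicate (hM : IsNIPStructure L M) {S : Set M}
    (hS : HasHonestDefinition L {a : Unit → M | a () ∈ S}) {α : Type} [Finite α] {n : ℕ}
    (φ : (L.sum predicate).BoundedFormula α n) :
    letI := predicate.structure S
    HasHonestDefinition L
      {a : α ⊕ Fin n → M | φ.Realize (a ∘ Sum.inl) (a ∘ Sum.inr)} := by
  let _ := predicate.structure S
  have elim_comp {n : ℕ} (a : α ⊕ Fin n → M) : Sum.elim (a ∘ Sum.inl) (a ∘ Sum.inr) = a :=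
    Sum.elim_comp_inl_inr a
  induction φ with
  | falsum => exact coversFinitely_empty ∅
  | equal t₁ t₂ =>
    obtain ⟨t₁', h₁⟩ := exists_term_realize_eq S t₁
    obtain ⟨t₂', h₂⟩ := exists_term_realize_eq S t₂
    convert hasHonestDefinition_setOf_realize (M := M) (Term.equal t₁' t₂') using 3 with a
    rw [Formula.realize_equal, h₁, h₂]
    simp only [BoundedFormula.Realize, elim_comp]
  | @rel n l R ts =>
    choose ts' hts' using fun i => exists_term_realize_eq S (ts i)
    rcases R with R | R
    · convert hasHonestDefinition_setOf_realize (M := M) (R.formula ts') using 3 with a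
      rw [Formula.realize_rel]
      simp only [BoundedFormula.Realize, elim_comp, hts']
      rfl
    · cases R
      convert hS.preimage_terms fun _ => ts' 0 using 3 with a
      simp only [BoundedFormula.Realize, elim_comp, hts']
      rfl
  | @imp n φ ψ hφ hψ =>
    convert (hφ.compl hM).union hψ using 1
    ext a
    simp [imp_iff_not_or]
  | @all n φ hφ =>
    -- `∀ y, φ` is the complement of the projection of `¬ φ`.
    let e : α ⊕ Fin (n + 1) → (α ⊕ Fin n) ⊕ Unit :=
      Sum.elim (fun i => Sum.inl (Sum.inl i))
        (Fin.lastCases (motive := fun _ => (α ⊕ Fin n) ⊕ Unit) (Sum.inr ())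
          fun i => Sum.inl (Sum.inr i))
    convert ((hφ.compl hM).preimage_terms fun i => Term.var (e i)).exists.compl hM using 1
    ext a
    have (c : Unit → M) : (fun i => (Term.var (e i) : L.Term _).realize (Sum.elim a c)) =
        Sum.elim (a ∘ Sum.inl) (Fin.snoc (a ∘ Sum.inr) (c ())) := by
      ext (i | i)
      · rfl
      · refine Fin.lastCases ?_ (fun i => ?_) i <;> simp [e]
    simp only [Set.mem_compl_iff, Set.mem_ofPred_eq, this, not_exists, not_not,
      Sum.elim_comp_inl, Sum.elim_comp_inr, BoundedFormula.realize_all]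
    exact ⟨fun h c => h (c ()), fun h y => h fun _ => y⟩

/-- Expanding a NIP structure by an externally definable set preserves NIP: shattering a finite
set of tuples in the expansion only involves finitely many points of `M`, on which the formula
agrees with an `L`-formula with parameters. -/
theorem IsNIPStructure.sum_predicate (hM : IsNIPStructure L M) {S : Set M}
    (hS : HasHonestDefinition L {a : Unit → M | a () ∈ S}) :
    letI := predicate.structure S
    IsNIPStructure (L.sum predicate) M := by
  let _ := predicate.structure S
  intro k m φ
  have hφ := (hasHonestDefinition_of_predicate hM hS φ).preimage_terms
    (Sum.elim Term.var (Fin.elim0 : Fin 0 → L.Term (Fin k ⊕ Fin m)))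
  obtain ⟨β, hβ, ψ, hψ⟩ := hφ.isExternallyDefinable
  let e : (Fin k ⊕ Fin m) ⊕ β ≃ Fin k ⊕ (Fin m ⊕ β) := Equiv.sumAssoc _ _ _
  obtain ⟨n, hn⟩ := hM.exists_not_shatters (ψ.relabel e)
  refine ⟨n, fun ⟨a, b, hab⟩ => hn ?_⟩
  obtain ⟨c, hc⟩ := hψ (Set.range fun p : Fin n × Set (Fin n) => Sum.elim (a p.1) (b p.2))
    (Set.finite_range _)
  refine ⟨a, fun s => Sum.elim (b s) c, fun i s => ?_⟩
  rw [← hab i s, Formula.realize_relabel]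
  have : Sum.elim (a i) (Sum.elim (b s) c) ∘ e = Sum.elim (Sum.elim (a i) (b s)) c := by
    ext ((i | i) | i) <;> rfl
  rw [this, hc _ ⟨(i, s), rfl⟩, Set.mem_ofPred_eq, Formula.Realize, Set.mem_ofPred_eq]
  have h0 (a : Fin 0 → M) : a = default := Subsingleton.elim _ _
  rw [h0 (_ ∘ Sum.inr)]
  rfl

end Expansion

end FirstOrder.Language

/-! ### Convex valuation rings -/

open FirstOrder.Language in
/-- A convex valuation ring is the union of the intervals `(-c, c)` with `c` in it, so these
intervals form an honest definition. -/
theorem hasHonestDefinition_valuation_integer {L : FirstOrder.Language.{u, v}}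
    {K : Type w} [Field K] [LinearOrder K] [IsStrictOrderedRing K] [L.Structure K]
    (ι : FirstOrder.Language.orderedField →ᴸ L) [ι.IsExpansionOn K]
    {Γ₀ : Type x} [LinearOrderedCommGroupWithZero Γ₀]
    (val : Valuation K Γ₀) (hval : val.IsLTConvex) :
    HasHonestDefinition L {a : Unit → K | a () ∈ (val.integer : Set K)} := by
  let X : orderedField.Term (Unit ⊕ Unit) := Term.var (Sum.inl ())
  let C : orderedField.Term (Unit ⊕ Unit) := Term.var (Sum.inr ())
  let ltSymb : orderedField.Relations 2 := orderedFieldRel.lt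
  let negSymb : orderedField.Functions 1 := ringFunc.neg
  let ψ : orderedField.Formula (Unit ⊕ Unit) := ltSymb.formula₂ X C ⊓ ltSymb.formula₂ (negSymb.apply₁ X) C
  have hψ (a c : Unit → K) :
      (ι.onFormula ψ).Realize (Sum.elim a c) ↔ a () < c () ∧ - a () < c () := by
    rw [LHom.realize_onFormula, Formula.realize_inf, Formula.realize_rel₂, Formula.realize_rel₂,
      Term.realize_functions_apply₁]
    rfl
  refine ⟨Unit, inferInstance, ι.onFormula ψ, fun F hF hFX => ?_⟩
  obtain ⟨c, hc, hcF⟩ : ∃ c ∈ val.integer, ∀ a ∈ F, a () < c ∧ - a () < c := by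
    induction F, hF using Set.Finite.induction_on with
    | empty => exact ⟨0, zero_mem _, by simp⟩
    | @insert a F _ _ ih =>
      obtain ⟨c, hc, hcF⟩ := ih ((Set.subset_insert a F).trans hFX)
      have ha : a () ∈ ltConvexHull val.integer := hval ▸ hFX (Set.mem_insert a F)
      obtain ⟨c', hc', h⟩ := ha
      refine ⟨max c c', by rcases max_choice c c' with h | h <;> rwa [h], ?_⟩
      rintro b (rfl | hb)
      · exact ⟨lt_max_of_lt_right h.1, lt_max_of_lt_right h.2⟩
      · exact ⟨lt_max_of_lt_left (hcF b hb).1, lt_max_of_lt_left (hcF b hb).2⟩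
  refine ⟨fun _ => c, fun a ha => (hψ a _).2 (hcF a ha), fun a ha => ?_⟩
  have : a () ∈ ltConvexHull val.integer := ⟨c, hc, (hψ a _).1 ha⟩
  exact hval ▸ this

theorem mainTheorem12 {L : FirstOrder.Language.{u, v}}
    {K : Type w} [Field K] [LinearOrder K] [IsStrictOrderedRing K]
    [L.Structure K]
    (ι : FirstOrder.Language.orderedField →ᴸ L) [ι.IsExpansionOn K]
    (hK : FirstOrder.Language.Theory.IsNIP.{u, v, w} (L.completeTheory K))
    {Γ₀ : Type x} [LinearOrderedCommGroupWithZero Γ₀]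
    (val : Valuation K Γ₀) (hval : val.IsLTConvex) :
    FirstOrder.Language.Theory.IsNIP.{u, v, w}
      (L.completeTheoryWithPredicate K (val.integer : Set K)) := by
  let _ := FirstOrder.Language.predicate.structure (val.integer : Set K)
  exact ((FirstOrder.Language.isNIPStructure_of_isNIP_completeTheory hK).sum_predicate
    (hasHonestDefinition_valuation_integer ι val hval)).isNIP_completeTheory
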